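/- Let $\mathcal H_1,\mathcal H_2,\mathcal H$ be separable real Hilbert spaces and let $\mathcal B_2=\mathcal B_2(\mathcal H_1;\mathcal H_2)$ be the Hilbert space of Hilbert–Schmidt operators $\mathcal H_1\to\mathcal H_2$, with inner product $\langle G,K\rangle=\sum_j\langle Ge_j,Ke_j\rangle$ for an orthonormal basis $(e_j)$ of $\mathcal H_1$. For $u\in\mathcal H_1$, $v\in\mathcal H_2$ let $u\otimes v\in\mathcal B_2$ be the operator $a\mapsto\langle u,a\rangle v$. For $G\in\mathcal B_2$ let $\|G\|$ be its operator norm and $\|G\|_*\in[0,+\infty]$ its nuclear norm, i.e. the sum of its singular values counted with multiplicity. Let $N\ge 1$, and for $1\le i\le N$ let $u_i\in\mathcal H_1$, $v_i\in\mathcal H_2$ be unit vectors and $\sigma_i>0$. Put $F^\dagger=(\sigma_i\,u_i\otimes v_i)_{1\le i\le N}\in\mathcal B_2^N$. Let $\Phi:\mathcal B_2^N\to\mathcal H$ be a bounded linear operator with adjoint $\Phi^*:\mathcal H\to\mathcal B_2^N$, where $\mathcal B_2^N$ carries the inner product $\langle F,G\rangle=\sum_{i=1}^N\langle F_i,G_i\rangle$,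 and let $z=\Phi F^\dagger$. Assume that 1. (non-degenerate source condition) there exist $H\in\operatorname{Im}(\Phi^*)$ and $W_1,\dots,W_N\in\mathcal B_2$ such that, for every $1\le i\le N$, $H_i=u_i\otimes v_i+W_i$ with $W_iu_i=0$, $W_i^*v_i=0$ and $\|W_i\|<1$; 2. $\Phi$ is injective on the cone $\mathcal C=\prod_{1\le i\le N}\{\alpha_i\,u_i\otimes v_i:\alpha_i\ge 0\}$. Then $F^\dagger$ is the unique solution of $$\min_{F\in\mathcal B_2^N}\ \sum_{i=1}^N\|F_i\|_*\quad\text{subject to}\quad \Phi F=z .$$ -/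

import Mathlib

open scoped ENNReal InnerProductSpace

noncomputable section

namespace NuclearRecovery

/-! ### Hilbert–Schmidt operators -/

section HilbertSchmidt

variable {H₁ H₂ : Type*}
  [NormedAddCommGroup H₁] [InnerProductSpace ℝ H₁] [CompleteSpace H₁]
  [NormedAddCommGroup H₂] [InnerProductSpace ℝ H₂] [CompleteSpace H₂]

/-- A bounded operator `G : H₁ → H₂` is Hilbert–Schmidt if `∑ ‖G eᵢ‖² < ∞` for some orthonormal
(Hilbert) basis `(eᵢ)` of `H₁`; by `isHilbertSchmidt_iff` the choice of the basis is irrelevant. -/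
def IsHilbertSchmidt (G : H₁ →L[ℝ] H₂) : Prop :=
  ∃ (w : Set H₁) (e : HilbertBasis w ℝ H₁), Summable fun i => ‖G (e i)‖ ^ 2

theorem tsum_ofReal_inner_sq {E ι : Type*} [NormedAddCommGroup E] [InnerProductSpace ℝ E]
    (e : HilbertBasis ι ℝ E) (x : E) :
    ∑' i, ENNReal.ofReal (⟪x, e i⟫_ℝ ^ 2) = ENNReal.ofReal (‖x‖ ^ 2) := by
  have h := e.hasSum_inner_mul_inner x x
  have h' : HasSum (fun i => ⟪x, e i⟫_ℝ ^ 2) (‖x‖ ^ 2) := by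
    rw [← real_inner_self_eq_norm_sq]
    refine h.congr_fun ?_
    intro i
    rw [real_inner_comm x (e i), sq]
  rw [← h'.tsum_eq, ENNReal.ofReal_tsum_of_nonneg (fun i => sq_nonneg _) h'.summable]

theorem tsum_ofReal_norm_sq_eq_adjoint {ι κ : Type*} (e : HilbertBasis ι ℝ H₁)
    (f : HilbertBasis κ ℝ H₂) (G : H₁ →L[ℝ] H₂) :
    ∑' i, ENNReal.ofReal (‖G (e i)‖ ^ 2) =
      ∑' j, ENNReal.ofReal (‖ContinuousLinearMap.adjoint G (f j)‖ ^ 2) := by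
  simp_rw [← tsum_ofReal_inner_sq f, ← tsum_ofReal_inner_sq e]
  rw [ENNReal.tsum_comm]
  refine tsum_congr fun j => tsum_congr fun i => ?_
  rw [ContinuousLinearMap.adjoint_inner_left, real_inner_comm]

theorem tsum_ofReal_norm_sq_eq {ι κ : Type*} (e : HilbertBasis ι ℝ H₁) (f : HilbertBasis κ ℝ H₁)
    (G : H₁ →L[ℝ] H₂) :
    ∑' i, ENNReal.ofReal (‖G (e i)‖ ^ 2) = ∑' j, ENNReal.ofReal (‖G (f j)‖ ^ 2) := by
  obtain ⟨w, b, -⟩ := exists_hilbertBasis ℝ H₂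
  rw [tsum_ofReal_norm_sq_eq_adjoint e b, tsum_ofReal_norm_sq_eq_adjoint f b]

theorem summable_norm_sq_iff {ι : Type*} (e : HilbertBasis ι ℝ H₁) (G : H₁ →L[ℝ] H₂) :
    (Summable fun i => ‖G (e i)‖ ^ 2) ↔ ∑' i, ENNReal.ofReal (‖G (e i)‖ ^ 2) ≠ ∞ := by
  constructor
  · intro h
    exact h.tsum_ofReal_ne_top
  · intro h
    refine (ENNReal.summable_toReal h).congr fun i => ?_
    exact ENNReal.toReal_ofReal (sq_nonneg _)

theorem isHilbertSchmidt_iff {ι : Type*} (e : HilbertBasis ι ℝ H₁) (G : H₁ →L[ℝ] H₂) :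
    IsHilbertSchmidt G ↔ Summable fun i => ‖G (e i)‖ ^ 2 := by
  constructor
  · rintro ⟨w, b, hb⟩
    rw [summable_norm_sq_iff] at hb ⊢
    rwa [tsum_ofReal_norm_sq_eq e b]
  · intro h
    obtain ⟨w, b, -⟩ := exists_hilbertBasis ℝ H₁
    refine ⟨w, b, ?_⟩
    rw [summable_norm_sq_iff] at h ⊢
    rwa [tsum_ofReal_norm_sq_eq b e]

theorem memLp_iff {ι : Type*} (f : ι → H₂) :
    Memℓp f 2 ↔ Summable fun i => ‖f i‖ ^ 2 := by
  rw [memℓp_gen_iff (by norm_num)]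
  simp

theorem isHilbertSchmidt_iff_memLp {ι : Type*} (e : HilbertBasis ι ℝ H₁) (G : H₁ →L[ℝ] H₂) :
    IsHilbertSchmidt G ↔ Memℓp (fun i => G (e i)) 2 := by
  rw [isHilbertSchmidt_iff e, memLp_iff]

variable (H₁ H₂) in
/-- The Hilbert–Schmidt operators, as a linear subspace of the bounded operators. -/
def hilbertSchmidtSubmodule : Submodule ℝ (H₁ →L[ℝ] H₂) where
  carrier := {G | IsHilbertSchmidt G}
  zero_mem' := by
    obtain ⟨w, b, -⟩ := exists_hilbertBasis ℝ H₁
    exact ⟨w, b, by simp⟩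
  add_mem' := by
    intro F G hF hG
    obtain ⟨w, b, -⟩ := exists_hilbertBasis ℝ H₁
    have hF' := (isHilbertSchmidt_iff_memLp b F).1 hF
    have hG' := (isHilbertSchmidt_iff_memLp b G).1 hG
    exact (isHilbertSchmidt_iff_memLp b (F + G)).2 (hF'.add hG')
  smul_mem' := by
    intro c G hG
    obtain ⟨w, b, -⟩ := exists_hilbertBasis ℝ H₁
    have hG' := (isHilbertSchmidt_iff_memLp b G).1 hG
    exact (isHilbertSchmidt_iff_memLp b (c • G)).2 (hG'.const_smul c)

variable (H₁ H₂) in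
/-- The space of Hilbert–Schmidt operators `H₁ → H₂`. It is a type of its own, because its norm is
the Hilbert–Schmidt norm and not the operator norm. -/
def HilbertSchmidt : Type _ := hilbertSchmidtSubmodule H₁ H₂

namespace HilbertSchmidt

instance : AddCommGroup (HilbertSchmidt H₁ H₂) :=
  inferInstanceAs (AddCommGroup (hilbertSchmidtSubmodule H₁ H₂))

instance : Module ℝ (HilbertSchmidt H₁ H₂) :=
  inferInstanceAs (Module ℝ (hilbertSchmidtSubmodule H₁ H₂))

/-- The bounded operator underlying a Hilbert–Schmidt operator. -/
def toCLM : HilbertSchmidt H₁ H₂ →ₗ[ℝ] (H₁ →L[ℝ] H₂) := (hilbertSchmidtSubmodule H₁ H₂).subtype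

theorem toCLM_injective : Function.Injective (toCLM : HilbertSchmidt H₁ H₂ →ₗ[ℝ] (H₁ →L[ℝ] H₂)) :=
  Subtype.val_injective

theorem isHilbertSchmidt (G : HilbertSchmidt H₁ H₂) : IsHilbertSchmidt (toCLM G) := G.2

/-- A bounded operator that is Hilbert–Schmidt, as an element of `HilbertSchmidt H₁ H₂`. -/
def mk (G : H₁ →L[ℝ] H₂) (hG : IsHilbertSchmidt G) : HilbertSchmidt H₁ H₂ := ⟨G, hG⟩

@[simp] theorem toCLM_mk (G : H₁ →L[ℝ] H₂) (hG : IsHilbertSchmidt G) : toCLM (mk G hG) = G := rfl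

/-- The sequence `(G eᵢ)ᵢ ∈ ℓ²(H₂)` of the values of `G` on a Hilbert basis `e`. -/
def values {ι : Type*} (e : HilbertBasis ι ℝ H₁) :
    HilbertSchmidt H₁ H₂ →ₗ[ℝ] lp (fun _ : ι => H₂) 2 where
  toFun G := ⟨fun i => toCLM G (e i), (isHilbertSchmidt_iff_memLp e _).1 G.isHilbertSchmidt⟩
  map_add' F G := by
    ext i
    simp only [map_add, add_apply]
    rfl
  map_smul' c G := by ext i; simp

theorem values_apply {ι : Type*} (e : HilbertBasis ι ℝ H₁) (G : HilbertSchmidt H₁ H₂) (i : ι) :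
    values e G i = toCLM G (e i) := rfl

theorem ext_basis {ι : Type*} (e : HilbertBasis ι ℝ H₁) {F G : H₁ →L[ℝ] H₂}
    (h : ∀ i, F (e i) = G (e i)) : F = G := by
  refine ContinuousLinearMap.ext_on (s := Set.range e) ?_ ?_
  · exact Submodule.dense_iff_topologicalClosure_eq_top.2 e.dense_span
  · rintro _ ⟨i, rfl⟩
    exact h i

theorem values_injective {ι : Type*} (e : HilbertBasis ι ℝ H₁) :
    Function.Injective (values e : HilbertSchmidt H₁ H₂ →ₗ[ℝ] lp (fun _ : ι => H₂) 2) := by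
  intro F G h
  apply toCLM_injective
  refine ext_basis e fun i => ?_
  have := congrArg (fun f : lp (fun _ : ι => H₂) 2 => f i) h
  exact this

variable (H₁) in
/-- The index set of a Hilbert basis of `H₁`, fixed once and for all. -/
def basisIndex : Set H₁ := (exists_hilbertBasis ℝ H₁).choose

variable (H₁) in
/-- A Hilbert basis of `H₁`, fixed once and for all. -/
def basis : HilbertBasis (basisIndex H₁) ℝ H₁ := (exists_hilbertBasis ℝ H₁).choose_spec.choose

/-- The Hilbert–Schmidt inner product `⟨G, H⟩ = ∑ᵢ ⟨G eᵢ, H eᵢ⟩`; by `inner_eq_tsum` it does not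
depend on the Hilbert basis `e`. -/
instance : Inner ℝ (HilbertSchmidt H₁ H₂) where
  inner G H := ∑' i, ⟪toCLM G (basis H₁ i), toCLM H (basis H₁ i)⟫_ℝ

theorem inner_def (G H : HilbertSchmidt H₁ H₂) :
    ⟪G, H⟫_ℝ = ∑' i, ⟪toCLM G (basis H₁ i), toCLM H (basis H₁ i)⟫_ℝ := rfl

theorem inner_eq_values (G H : HilbertSchmidt H₁ H₂) :
    ⟪G, H⟫_ℝ = ⟪values (basis H₁) G, values (basis H₁) H⟫_ℝ :=
  (lp.inner_eq_tsum (values (basis H₁) G) (values (basis H₁) H)).symm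

/-- The axioms of an inner product for the Hilbert–Schmidt inner product. -/
@[reducible]
def core : InnerProductSpace.Core ℝ (HilbertSchmidt H₁ H₂) where
  inner := inner ℝ
  conj_inner_symm x y := by
    simp only [inner_eq_values]
    exact inner_conj_symm _ _
  re_inner_nonneg x := by
    rw [inner_eq_values]
    exact inner_self_nonneg
  add_left x y z := by simp only [inner_eq_values, map_add, inner_add_left]
  smul_left x y r := by simp only [inner_eq_values, map_smul, inner_smul_left]
  definite x h := by
    rw [inner_eq_values, inner_self_eq_zero] at h
    exact values_injective _ (by rw [h, map_zero])

instance : NormedAddCommGroup (HilbertSchmidt H₁ H₂) := core.toNormedAddCommGroup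

instance : InnerProductSpace ℝ (HilbertSchmidt H₁ H₂) :=
  InnerProductSpace.ofCore core.toCore

theorem norm_sq_values {ι : Type*} (e : HilbertBasis ι ℝ H₁) (G : HilbertSchmidt H₁ H₂) :
    ‖values e G‖ ^ 2 = (∑' i, ENNReal.ofReal (‖toCLM G (e i)‖ ^ 2)).toReal := by
  rw [← ENNReal.ofReal_tsum_of_nonneg (fun i => sq_nonneg _)
    ((isHilbertSchmidt_iff e _).1 G.isHilbertSchmidt),
    ENNReal.toReal_ofReal (tsum_nonneg fun i => sq_nonneg _), ← real_inner_self_eq_norm_sq,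
    lp.inner_eq_tsum]
  simp_rw [values_apply, real_inner_self_eq_norm_sq]

theorem inner_eq_inner_values {ι : Type*} (e : HilbertBasis ι ℝ H₁) (G H : HilbertSchmidt H₁ H₂) :
    ⟪G, H⟫_ℝ = ⟪values e G, values e H⟫_ℝ := by
  have key : ∀ K : HilbertSchmidt H₁ H₂, ‖values e K‖ ^ 2 = ‖values (basis H₁) K‖ ^ 2 := by
    intro K
    rw [norm_sq_values, norm_sq_values, tsum_ofReal_norm_sq_eq e (basis H₁)]
  have h₁ := key (G + H)
  have h₂ := key (G - H)
  rw [map_add, map_add, norm_add_sq_real, norm_add_sq_real] at h₁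
  rw [map_sub, map_sub, norm_sub_sq_real, norm_sub_sq_real] at h₂
  rw [inner_eq_values]
  linarith

/-- The inner product of `HilbertSchmidt H₁ H₂`, computed in an arbitrary Hilbert basis. -/
theorem inner_eq_tsum {ι : Type*} (e : HilbertBasis ι ℝ H₁) (G H : HilbertSchmidt H₁ H₂) :
    ⟪G, H⟫_ℝ = ∑' i, ⟪toCLM G (e i), toCLM H (e i)⟫_ℝ := by
  rw [inner_eq_inner_values e, lp.inner_eq_tsum]
  rfl

theorem norm_values {ι : Type*} (e : HilbertBasis ι ℝ H₁) (G : HilbertSchmidt H₁ H₂) :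
    ‖values e G‖ = ‖G‖ := by
  have h : ‖values e G‖ ^ 2 = ‖G‖ ^ 2 := by
    rw [← real_inner_self_eq_norm_sq, ← real_inner_self_eq_norm_sq, inner_eq_inner_values e]
  exact (sq_eq_sq₀ (norm_nonneg _) (norm_nonneg _)).1 h

theorem values_surjective {ι : Type*} (e : HilbertBasis ι ℝ H₁) :
    Function.Surjective (values e : HilbertSchmidt H₁ H₂ →ₗ[ℝ] lp (fun _ : ι => H₂) 2) := by
  intro f
  have hf : Summable fun i => ‖f i‖ ^ (2 : ℝ) := by
    have := (memLp_iff (fun i => f i)).1 (lp.memℓp f)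
    simpa using this
  have hx : ∀ x : H₁, Summable fun i => |⟪e i, x⟫_ℝ| ^ (2 : ℝ) := by
    intro x
    have := (e.summable_inner_mul_inner x x)
    refine this.congr fun i => ?_
    rw [Real.rpow_two, sq_abs, sq, real_inner_comm x (e i)]
  have hxs : ∀ x : H₁, ∑' i, |⟪e i, x⟫_ℝ| ^ (2 : ℝ) = ‖x‖ ^ 2 := by
    intro x
    rw [← real_inner_self_eq_norm_sq, ← e.tsum_inner_mul_inner x x]
    refine tsum_congr fun i => ?_
    rw [Real.rpow_two, sq_abs, sq, real_inner_comm x (e i)]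
  have hol : ∀ x : H₁, (Summable fun i => |⟪e i, x⟫_ℝ| * ‖f i‖) ∧
      ∑' i, |⟪e i, x⟫_ℝ| * ‖f i‖ ≤ (∑' i, |⟪e i, x⟫_ℝ| ^ (2 : ℝ)) ^ (1 / (2 : ℝ)) *
        (∑' i, ‖f i‖ ^ (2 : ℝ)) ^ (1 / (2 : ℝ)) := by
    intro x
    exact Real.summable_and_inner_le_Lp_mul_Lq_tsum_of_nonneg Real.HolderConjugate.two_two
      (fun i => abs_nonneg _) (fun i => norm_nonneg _) (hx x) hf
  have hsn : ∀ x : H₁, Summable fun i => ‖⟪e i, x⟫_ℝ • f i‖ := by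
    intro x
    simpa only [norm_smul, Real.norm_eq_abs] using (hol x).1
  have hs : ∀ x : H₁, Summable fun i => ⟪e i, x⟫_ℝ • f i := fun x => (hsn x).of_norm
  let L : H₁ →ₗ[ℝ] H₂ :=
    { toFun := fun x => ∑' i, ⟪e i, x⟫_ℝ • f i
      map_add' := fun x y => by
        simp only [inner_add_right, add_smul]
        exact (hs x).tsum_add (hs y)
      map_smul' := fun c x => by
        simp only [inner_smul_right, mul_smul, RingHom.id_apply]
        exact (hs x).tsum_const_smul c }
  let G : H₁ →L[ℝ] H₂ := L.mkContinuous ((∑' i, ‖f i‖ ^ (2 : ℝ)) ^ (1 / (2 : ℝ))) (by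
    intro x
    refine (norm_tsum_le_tsum_norm (hsn x)).trans ?_
    simp only [norm_smul, Real.norm_eq_abs]
    refine (hol x).2.trans (le_of_eq ?_)
    rw [hxs, ← Real.sqrt_eq_rpow, Real.sqrt_sq (norm_nonneg _), mul_comm])
  have hG : ∀ i, G (e i) = f i := by
    intro i
    change ∑' j, ⟪e j, e i⟫_ℝ • f j = f i
    rw [tsum_eq_single i]
    · rw [real_inner_self_eq_norm_sq, e.orthonormal.1 i]
      simp
    · intro j hj
      rw [e.orthonormal.2 hj, zero_smul]
  have hHS : IsHilbertSchmidt G := by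
    rw [isHilbertSchmidt_iff_memLp e]
    simp only [hG]
    exact lp.memℓp f
  refine ⟨mk G hHS, ?_⟩
  ext i
  rw [values_apply, toCLM_mk, hG]

instance : CompleteSpace (HilbertSchmidt H₁ H₂) := by
  let J : HilbertSchmidt H₁ H₂ ≃ₗᵢ[ℝ] lp (fun _ : basisIndex H₁ => H₂) 2 :=
    { LinearEquiv.ofBijective (values (basis H₁)) ⟨values_injective _, values_surjective _⟩ with
      norm_map' := norm_values (basis H₁) }
  exact (completeSpace_congr (e := J.toEquiv) J.isometry.isUniformEmbedding).2 inferInstance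

theorem isHilbertSchmidt_rankOne (u : H₁) (v : H₂) :
    IsHilbertSchmidt (InnerProductSpace.rankOne ℝ v u) := by
  rw [isHilbertSchmidt_iff (basis H₁)]
  have h := (basis H₁).summable_inner_mul_inner u u
  refine (h.mul_right (‖v‖ ^ 2)).congr fun i => ?_
  rw [InnerProductSpace.rankOne_apply, norm_smul, mul_pow, Real.norm_eq_abs, sq_abs, sq ⟪_, _⟫_ℝ,
    real_inner_comm u]

/-- The rank-one operator `u ⊗ v : a ↦ ⟨u, a⟩ v`. -/
def tensor (u : H₁) (v : H₂) : HilbertSchmidt H₁ H₂ :=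
  mk (InnerProductSpace.rankOne ℝ v u) (isHilbertSchmidt_rankOne u v)

@[simp] theorem toCLM_tensor_apply (u : H₁) (v : H₂) (a : H₁) :
    toCLM (tensor u v) a = ⟪u, a⟫_ℝ • v := rfl

end HilbertSchmidt

end HilbertSchmidt

/-! ### The nuclear norm and the recovery problem -/

section Recovery

variable {H₁ H₂ H : Type*}
  [NormedAddCommGroup H₁] [InnerProductSpace ℝ H₁] [CompleteSpace H₁]
  [NormedAddCommGroup H₂] [InnerProductSpace ℝ H₂] [CompleteSpace H₂]
  [NormedAddCommGroup H] [InnerProductSpace ℝ H] [CompleteSpace H]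

/-- The multiplicity of `s > 0` as a singular value of `G`, that is, the dimension of the eigenspace
of `G* G` for the eigenvalue `s ^ 2` (it is `0` if `s` is not a singular value of `G`). -/
def singularMultiplicity (G : HilbertSchmidt H₁ H₂) (s : ℝ) : ℕ∞ :=
  Cardinal.toENat <| Module.rank ℝ <| Module.End.eigenspace
    (ContinuousLinearMap.adjoint G.toCLM ∘L G.toCLM : H₁ →L[ℝ] H₁).toLinearMap (s ^ 2)

/-- The nuclear norm `‖G‖_* ∈ [0, ∞]`: the sum of the singular values of `G`, each counted with its
multiplicity. -/
def nuclearNorm (G : HilbertSchmidt H₁ H₂) : ℝ≥0∞ :=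
  ∑' s : Set.Ioi (0 : ℝ), (singularMultiplicity G s : ℝ≥0∞) * ENNReal.ofReal s

/-- The Hilbert space `B₂(H₁; H₂)^N` of `N`-tuples of Hilbert–Schmidt operators, with the inner
product `⟨F, G⟩ = ∑ i, ⟨F i, G i⟩`. -/
abbrev HSTuple (N : ℕ) (H₁ H₂ : Type*)
    [NormedAddCommGroup H₁] [InnerProductSpace ℝ H₁] [CompleteSpace H₁]
    [NormedAddCommGroup H₂] [InnerProductSpace ℝ H₂] [CompleteSpace H₂] : Type _ :=
  PiLp 2 fun _ : Fin N => HilbertSchmidt H₁ H₂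

/-- `F` solves the problem: minimize `∑ i, ‖F i‖_*` over `F ∈ B₂(H₁; H₂)^N` subject to `Φ F = z`. -/
def IsSolution {N : ℕ} (Φ : HSTuple N H₁ H₂ →L[ℝ] H) (z : H) (F : HSTuple N H₁ H₂) : Prop :=
  Φ F = z ∧ ∀ G : HSTuple N H₁ H₂, Φ G = z → ∑ i, nuclearNorm (F i) ≤ ∑ i, nuclearNorm (G i)

/-- The non-degenerate source condition: some `K` in the range of `Φ*` satisfies
`K i = u i ⊗ v i + W i` with `W i (u i) = 0`, `(W i)* (v i) = 0` and operator norm `‖W i‖ < 1`. -/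
def NonDegenerateSourceCondition {N : ℕ} (Φ : HSTuple N H₁ H₂ →L[ℝ] H)
    (u : Fin N → H₁) (v : Fin N → H₂) : Prop :=
  ∃ K ∈ Set.range (ContinuousLinearMap.adjoint Φ), ∀ i, ∃ W : HilbertSchmidt H₁ H₂,
    K i = HilbertSchmidt.tensor (u i) (v i) + W ∧
    W.toCLM (u i) = 0 ∧
    ContinuousLinearMap.adjoint W.toCLM (v i) = 0 ∧
    ‖W.toCLM‖ < 1

/-- The cone of the tuples `(α i • u i ⊗ v i)` with `α i ≥ 0`. -/
def modelCone {N : ℕ} (u : Fin N → H₁) (v : Fin N → H₂) : Set (HSTuple N H₁ H₂) :=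
  {F | ∀ i, ∃ α : ℝ, 0 ≤ α ∧ F i = α • HilbertSchmidt.tensor (u i) (v i)}

end Recovery

end NuclearRecovery

end

/-!
The proof is by a dual certificate. Write the certificate in the range of `Φ*` as
`K i = u i ⊗ v i + W i`. Pairing with `K` is constant on the feasible set `Φ F = z`, where its value
is `∑ i, ⟪K i, Fdag i⟫ = ∑ i, σ i`, while `∑ i, ‖Fdag i‖_* ≤ ∑ i, σ i`
(`nuclearNorm_smul_tensor_le`). So `Fdag` is optimal as soon as `⟪K i, G⟫ ≤ ‖G‖_*` for every `G`, and
every other solution `F` satisfies `⟪K i, F i⟫ = ‖F i‖_*` for all `i`. This equality forces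
`F i = α i • u i ⊗ v i` with `α i ≥ 0` (`inner_certificate_le`), so `F` lies in the cone on which `Φ`
is injective, and `F = Fdag`.

For the duality inequality, a Hilbert–Schmidt operator `G` is compact, being the sum of the rank-one
operators `e i ⊗ G (e i)` in the Hilbert–Schmidt norm, so the spectral theorem for `G* G` yields a
Hilbert basis `e` of right singular vectors of `G` (`exists_singular_basis`). The sum of the singular
values `‖G (e k)‖` is at most `‖G‖_*` (`tsum_norm_le_nuclearNorm`), and
`⟪K, G⟫ = ∑ k, ⟪K (e k), G (e k)⟫ ≤ ∑ k, ‖G (e k)‖` whenever `K` is a contraction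
(`exists_basis_of_norm_le_one`). In the case of equality `‖K (e k)‖ = 1` for each `k` with
`G (e k) ≠ 0`. Since `‖W‖ < 1`, the operator `K = u ⊗ v + W` preserves norms only on the line of `u`
(`norm_sq_certificate_le`). As the `e k` are orthogonal, at most one of them lies on that line, and
`G` is a nonnegative multiple of `u ⊗ v`.
-/

open scoped ENNReal InnerProductSpace

namespace NuclearRecovery

/-! ### The Hilbert–Schmidt inner product with rank-one operators -/

section RankOne

universe u₁

variable {H₁ : Type u₁} {H₂ : Type*}
  [NormedAddCommGroup H₁] [InnerProductSpace ℝ H₁] [CompleteSpace H₁]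
  [NormedAddCommGroup H₂] [InnerProductSpace ℝ H₂] [CompleteSpace H₂]

namespace HilbertSchmidt

theorem hasSum_inner {ι : Type*} (e : HilbertBasis ι ℝ H₁) (G K : HilbertSchmidt H₁ H₂) :
    HasSum (fun i => ⟪toCLM G (e i), toCLM K (e i)⟫_ℝ) ⟪G, K⟫_ℝ := by
  rw [inner_eq_inner_values e]
  exact lp.hasSum_inner (values e G) (values e K)

theorem inner_tensor_left (u : H₁) (v : H₂) (G : HilbertSchmidt H₁ H₂) :
    ⟪tensor u v, G⟫_ℝ = ⟪v, toCLM G u⟫_ℝ := by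
  rw [inner_eq_tsum (basis H₁), ← ContinuousLinearMap.adjoint_inner_left, real_inner_comm,
    ← (basis H₁).tsum_inner_mul_inner]
  refine tsum_congr fun i => ?_
  rw [toCLM_tensor_apply, real_inner_smul_left, ContinuousLinearMap.adjoint_inner_right,
    real_inner_comm v]

theorem norm_tensor (u : H₁) (v : H₂) : ‖tensor u v‖ = ‖u‖ * ‖v‖ := by
  have h : ‖tensor u v‖ ^ 2 = (‖u‖ * ‖v‖) ^ 2 := by
    rw [← real_inner_self_eq_norm_sq, inner_tensor_left, toCLM_tensor_apply, real_inner_smul_right,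
      real_inner_self_eq_norm_sq, real_inner_self_eq_norm_sq, mul_pow]
  exact (sq_eq_sq₀ (norm_nonneg _) (by positivity)).1 h

theorem norm_toCLM_le (G : HilbertSchmidt H₁ H₂) : ‖toCLM G‖ ≤ ‖G‖ := by
  refine ContinuousLinearMap.opNorm_le_bound _ (norm_nonneg _) fun x => ?_
  -- Cauchy–Schwarz for the pairing of `G` with `x ⊗ G x`, which equals `‖G x‖²`.
  have h := real_inner_le_norm (tensor x (toCLM G x)) G
  rw [inner_tensor_left, real_inner_self_eq_norm_sq, norm_tensor] at h
  rcases (norm_nonneg (toCLM G x)).eq_or_lt with h0 | h0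
  · rw [← h0]
    positivity
  · refine le_of_mul_le_mul_right ?_ h0
    linarith

/-! ### Compactness and singular bases -/

/-- A Hilbert–Schmidt operator is the sum `∑ i, e i ⊗ G (e i)`, convergent in the
Hilbert–Schmidt norm. -/
theorem hasSum_tensor {ι : Type*} (e : HilbertBasis ι ℝ H₁) (G : HilbertSchmidt H₁ H₂) :
    HasSum (fun i => tensor (e i) (toCLM G (e i))) G := by
  classical
  let J : HilbertSchmidt H₁ H₂ ≃ₗᵢ[ℝ] lp (fun _ : ι => H₂) 2 :=
    { LinearEquiv.ofBijective (values e) ⟨values_injective _, values_surjective _⟩ with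
      norm_map' := norm_values e }
  have h := lp.hasSum_single (p := 2) (by norm_num) (J G)
  have h' := h.mapL (J.symm.toContinuousLinearEquiv : _ →L[ℝ] HilbertSchmidt H₁ H₂)
  have hG : (J.symm.toContinuousLinearEquiv : _ →L[ℝ] HilbertSchmidt H₁ H₂) (J G) = G :=
    J.symm_apply_apply G
  rw [hG] at h'
  refine h'.congr_fun fun i => ?_
  refine J.injective ?_
  refine Eq.trans ?_ (J.apply_symm_apply _).symm
  ext j
  change toCLM (tensor (e i) (toCLM G (e i))) (e j) = _
  rw [toCLM_tensor_apply, lp.single_apply]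
  by_cases hij : i = j
  · subst hij
    rw [real_inner_self_eq_norm_sq, e.orthonormal.1 i, Pi.single_eq_same]
    simp
    rfl
  · rw [e.orthonormal.2 hij, Pi.single_eq_of_ne (Ne.symm hij), zero_smul]

theorem isCompactOperator_tensor (u : H₁) (v : H₂) :
    IsCompactOperator (toCLM (tensor u v)) :=
  (isCompactOperator_of_locallyCompactSpace_rng
    (ContinuousLinearMap.toSpanSingleton ℝ v)).comp_clm (innerSL ℝ u)

theorem isCompactOperator (G : HilbertSchmidt H₁ H₂) : IsCompactOperator (toCLM G) := by
  let L : HilbertSchmidt H₁ H₂ →L[ℝ] (H₁ →L[ℝ] H₂) :=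
    toCLM.mkContinuous 1 fun K => by simpa using norm_toCLM_le K
  refine isCompactOperator_of_tendsto ((hasSum_tensor (basis H₁) G).mapL L)
    (Filter.Eventually.of_forall fun s => ?_)
  exact (compactOperator (RingHom.id ℝ) H₁ H₂).sum_mem fun i _ => isCompactOperator_tensor _ _

/-- The operator `G* G`, whose eigenvalues are the squares of the singular values of `G`. -/
noncomputable abbrev gram (G : HilbertSchmidt H₁ H₂) : H₁ →L[ℝ] H₁ :=
  ContinuousLinearMap.adjoint G.toCLM ∘L G.toCLM

theorem inner_gram_left (G : HilbertSchmidt H₁ H₂) (x y : H₁) :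
    ⟪gram G x, y⟫_ℝ = ⟪toCLM G x, toCLM G y⟫_ℝ :=
  ContinuousLinearMap.adjoint_inner_left G.toCLM y (G.toCLM x)

theorem norm_sq_eq_of_gram_eq {G : HilbertSchmidt H₁ H₂} {x : H₁} {μ : ℝ} (hx : ‖x‖ = 1)
    (h : gram G x = μ • x) : ‖toCLM G x‖ ^ 2 = μ := by
  rw [← real_inner_self_eq_norm_sq, ← inner_gram_left, h, real_inner_smul_left,
    real_inner_self_eq_norm_sq, hx, one_pow, mul_one]

/-- The spectral theorem for `G* G`: there is a Hilbert basis of right singular vectors of `G`, the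
singular value of `e k` being `‖G (e k)‖`. -/
theorem exists_singular_basis (G : HilbertSchmidt H₁ H₂) :
    ∃ (ι : Type u₁) (e : HilbertBasis ι ℝ H₁), ∀ k, gram G (e k) = ‖toCLM G (e k)‖ ^ 2 • e k := by
  have hsymm : (gram G).toLinearMap.IsSymmetric := fun x y =>
    (inner_gram_left G x y).trans
      (by rw [real_inner_comm, ← inner_gram_left, real_inner_comm]; rfl)
  have hcpt : IsCompactOperator (gram G) := G.isCompactOperator.clm_comp
    (ContinuousLinearMap.adjoint G.toCLM)
  have htop := ContinuousLinearMap.orthogonalComplement_iSup_eigenspaces_eq_bot hcpt hsymm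
  let V (μ : ℝ) : Submodule ℝ H₁ := Module.End.eigenspace (gram G).toLinearMap μ
  have hV : ∀ μ, CompleteSpace (V μ) := fun μ => by
    refine IsClosed.completeSpace_coe (s := (V μ : Set H₁)) (hs := ?_)
    have : (V μ : Set H₁) = {x | gram G x = μ • x} := by
      ext x
      exact Module.End.mem_eigenspace_iff
    rw [this]
    exact isClosed_eq (gram G).continuous (continuous_const_smul μ)
  let b (μ : ℝ) : HilbertBasis (basisIndex (V μ)) ℝ (V μ) := basis (V μ)
  have hon : Orthonormal ℝ fun k : Σ μ, basisIndex (V μ) => (b k.1 k.2 : H₁) :=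
    hsymm.orthogonalFamily_eigenspaces.orthonormal_sigma_orthonormal
      fun μ => (b μ).orthonormal
  have hbot : (Submodule.span ℝ
      (Set.range fun k : Σ μ, basisIndex (V μ) => (b k.1 k.2 : H₁)))ᗮ = ⊥ := by
    rw [eq_bot_iff, ← htop]
    intro x hx
    rw [Submodule.mem_orthogonal] at hx ⊢
    have key : ∀ μ, ∀ y : V μ, ⟪(y : H₁), x⟫_ℝ = 0 := by
      intro μ
      have : (innerSL ℝ x ∘L (V μ).subtypeL) = 0 := ext_basis (b μ) fun j => by
        have := hx _ (Submodule.subset_span ⟨⟨μ, j⟩, rfl⟩)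
        rw [real_inner_comm] at this
        exact this
      intro y
      rw [real_inner_comm]
      exact DFunLike.congr_fun this y
    intro y hy
    have hle : (⨆ μ, V μ) ≤ (Submodule.span ℝ {x})ᗮ := iSup_le fun μ y hy => by
      rw [Submodule.mem_orthogonal_singleton_iff_inner_left]
      exact key μ ⟨y, hy⟩
    exact (Submodule.mem_orthogonal_singleton_iff_inner_left).1 (hle hy)
  refine ⟨_, HilbertBasis.mkOfOrthogonalEqBot hon hbot, ?_⟩
  rintro ⟨μ, j⟩
  rw [HilbertBasis.coe_mkOfOrthogonalEqBot]
  have h : gram G (b μ j : H₁) = μ • (b μ j : H₁) := Module.End.mem_eigenspace_iff.1 (b μ j).2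
  rw [norm_sq_eq_of_gram_eq (hon.1 ⟨μ, j⟩) h, h]

/-- The sum of the singular values over an orthonormal family of right singular vectors is at most
the nuclear norm: the members of the family with singular value `s` are linearly independent in the
eigenspace of `G* G` for `s ^ 2`. -/
theorem tsum_norm_le_nuclearNorm (G : HilbertSchmidt H₁ H₂) {ι : Type*} {e : ι → H₁}
    (he : Orthonormal ℝ e) (heig : ∀ k, gram G (e k) = ‖toCLM G (e k)‖ ^ 2 • e k) :
    ∑' k, ENNReal.ofReal ‖toCLM G (e k)‖ ≤ nuclearNorm G := by
  rw [nuclearNorm, tsum_subtype (Set.Ioi (0 : ℝ))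
    (fun s => (singularMultiplicity G s : ℝ≥0∞) * ENNReal.ofReal s),
    ← ENNReal.tsum_fiberwise _ fun k => ‖toCLM G (e k)‖]
  refine ENNReal.tsum_le_tsum fun s => ?_
  have hs : ∀ k : (fun k => ‖toCLM G (e k)‖) ⁻¹' {s}, ‖toCLM G (e k)‖ = s := fun k => k.2
  simp only [hs]
  by_cases h0 : s ∈ Set.Ioi (0 : ℝ)
  · rw [Set.indicator_of_mem h0, ENNReal.tsum_set_const]
    refine mul_le_mul_left ?_ _
    rw [ENat.toENNReal_le]
    let w : (fun k => ‖toCLM G (e k)‖) ⁻¹' {s} →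
        Module.End.eigenspace (gram G).toLinearMap (s ^ 2) := fun k =>
      ⟨e k, Module.End.mem_eigenspace_iff.2 (by
        have := heig k
        rw [hs k] at this
        exact this)⟩
    have hw : LinearIndependent ℝ w := by
      refine LinearIndependent.of_comp (Submodule.subtype _) ?_
      exact he.linearIndependent.comp _ Subtype.val_injective
    have h := OrderHomClass.mono Cardinal.toENat hw.cardinal_lift_le_rank
    rw [Cardinal.toENat_lift, Cardinal.toENat_lift] at h
    exact h
  · rw [Set.indicator_of_notMem h0, ENNReal.ofReal_of_nonpos (not_lt.1 h0)]
    simp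

/-- A rank-one operator `c • u ⊗ v` with unit vectors `u`, `v` and `c > 0` has nuclear norm at most
(in fact equal to) `c`: an eigenvector of `G* G` for a nonzero eigenvalue is a multiple of `u`. -/
theorem nuclearNorm_smul_tensor_le {u : H₁} {v : H₂} (hu : ‖u‖ = 1) (hv : ‖v‖ = 1) {c : ℝ}
    (hc : 0 < c) : nuclearNorm (c • tensor u v) ≤ ENNReal.ofReal c := by
  have happly : ∀ x, toCLM (c • tensor u v) x = (c * ⟪u, x⟫_ℝ) • v := fun x => by
    rw [map_smul, smul_apply, toCLM_tensor_apply, mul_smul]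
  generalize c • tensor u v = G at happly ⊢
  have hgram : ∀ x, gram G x = (c ^ 2 * ⟪u, x⟫_ℝ) • u := by
    intro x
    refine ext_inner_right ℝ fun y => ?_
    rw [inner_gram_left, happly, happly, real_inner_smul_left, real_inner_smul_left,
      real_inner_smul_right, real_inner_self_eq_norm_sq, hv]
    ring
  have hmem : ∀ s : ℝ, 0 < s → ∀ x ∈ Module.End.eigenspace
      (gram G).toLinearMap (s ^ 2), (c ^ 2 * ⟪u, x⟫_ℝ) • u = s ^ 2 • x := by
    intro s _ x hx
    rw [← hgram]
    exact Module.End.mem_eigenspace_iff.1 hx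
  have hspan : ∀ s : ℝ, 0 < s → Module.End.eigenspace
      (gram G).toLinearMap (s ^ 2) ≤ Submodule.span ℝ {u} := by
    intro s hs x hx
    rw [Submodule.mem_span_singleton]
    refine ⟨(s ^ 2)⁻¹ * (c ^ 2 * ⟪u, x⟫_ℝ), ?_⟩
    rw [mul_smul, hmem s hs x hx, inv_smul_smul₀ (by positivity)]
  have hle : ∀ s : ℝ, 0 < s → singularMultiplicity G s ≤ 1 := by
    intro s hs
    have h := (Submodule.rank_mono (hspan s hs)).trans (rank_span_le _)
    rw [Cardinal.mk_singleton] at h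
    exact (OrderHomClass.mono Cardinal.toENat h).trans_eq (map_one _)
  have hzero : ∀ s : ℝ, 0 < s → s ≠ c → singularMultiplicity G s = 0 := by
    intro s hs hsc
    have hbot : Module.End.eigenspace (gram G).toLinearMap (s ^ 2) = ⊥ := by
      rw [eq_bot_iff]
      intro x hx
      have h := hmem s hs x hx
      -- Pairing the eigenvalue equation with `u` gives `c² ⟪u, x⟫ = s² ⟪u, x⟫`.
      have h' := congrArg (fun y => ⟪u, y⟫_ℝ) h
      simp only [real_inner_smul_right, real_inner_self_eq_norm_sq, hu] at h'
      have hne : c ^ 2 - s ^ 2 ≠ 0 := fun h0 =>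
        hsc ((sq_eq_sq₀ hs.le hc.le).1 (by linarith))
      have h0 : ⟪u, x⟫_ℝ = 0 := by
        refine (mul_eq_zero.1 (?_ : (c ^ 2 - s ^ 2) * ⟪u, x⟫_ℝ = 0)).resolve_left hne
        linarith
      rw [h0, mul_zero, zero_smul] at h
      exact (Submodule.mem_bot ℝ).2 ((smul_eq_zero.1 h.symm).resolve_left (by positivity))
    have : Module.rank ℝ (Module.End.eigenspace
        (gram G).toLinearMap (s ^ 2)) = 0 := by
      rw [hbot, rank_bot]
    simp only [singularMultiplicity]
    rw [this, map_zero]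
  rw [nuclearNorm, tsum_eq_single (⟨c, hc⟩ : Set.Ioi (0 : ℝ))]
  · refine (mul_le_mul_left ?_ _).trans_eq (one_mul _)
    exact_mod_cast hle c hc
  · rintro ⟨s, hs⟩ hsc
    rw [hzero s hs fun h => hsc (Subtype.ext h)]
    simp

/-! ### Duality between the nuclear norm and the operator norm -/

/-- The Hilbert–Schmidt inner product with an operator of norm at most one is bounded by the nuclear
norm; in the case of equality, every vector of a suitable singular basis of `G` is either
annihilated by `G` or a vector on which `K` attains the norm one, in the direction of `G (e k)`. -/
theorem exists_basis_of_norm_le_one {G : HilbertSchmidt H₁ H₂} (hG : nuclearNorm G ≠ ∞)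
    {K : HilbertSchmidt H₁ H₂} (hK : ∀ x, ‖toCLM K x‖ ≤ ‖x‖) :
    ⟪K, G⟫_ℝ ≤ (nuclearNorm G).toReal ∧ (⟪K, G⟫_ℝ = (nuclearNorm G).toReal →
      ∃ (ι : Type u₁) (e : HilbertBasis ι ℝ H₁), ∀ k,
        toCLM G (e k) = ‖toCLM G (e k)‖ • toCLM K (e k) ∧
          (toCLM G (e k) = 0 ∨ ‖toCLM K (e k)‖ = 1)) := by
  obtain ⟨ι, e, he⟩ := exists_singular_basis G
  have hle := tsum_norm_le_nuclearNorm G e.orthonormal he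
  have hsum : Summable fun k => ‖toCLM G (e k)‖ := by
    refine (ENNReal.summable_toReal (ne_top_of_le_ne_top hG hle)).congr fun k => ?_
    exact ENNReal.toReal_ofReal (norm_nonneg _)
  have hle' : ∑' k, ‖toCLM G (e k)‖ ≤ (nuclearNorm G).toReal := by
    rw [← ENNReal.ofReal_le_iff_le_toReal hG,
      ENNReal.ofReal_tsum_of_nonneg (fun k => norm_nonneg _) hsum]
    exact hle
  have hK1 : ∀ k, ‖toCLM K (e k)‖ ≤ 1 := fun k => (hK _).trans_eq (e.orthonormal.1 k)
  have hterm : ∀ k, ⟪toCLM K (e k), toCLM G (e k)⟫_ℝ ≤ ‖toCLM G (e k)‖ := fun k =>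
    (real_inner_le_norm _ _).trans (mul_le_of_le_one_left (norm_nonneg _) (hK1 k))
  have hinner := hasSum_inner e K G
  have hbound : ⟪K, G⟫_ℝ ≤ ∑' k, ‖toCLM G (e k)‖ := hasSum_le hterm hinner hsum.hasSum
  refine ⟨hbound.trans hle', fun heq => ⟨ι, e, fun k => ?_⟩⟩
  have hdiff := hsum.hasSum.sub hinner
  rw [le_antisymm (hle'.trans heq.ge) hbound, sub_self,
    hasSum_zero_iff_of_nonneg fun k => sub_nonneg.2 (hterm k)] at hdiff
  have hk : ⟪toCLM K (e k), toCLM G (e k)⟫_ℝ = ‖toCLM G (e k)‖ :=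
    (sub_eq_zero.1 (congrFun hdiff k)).symm
  by_cases h0 : toCLM G (e k) = 0
  · simp [h0]
  · have hpos : 0 < ‖toCLM G (e k)‖ := norm_pos_iff.2 h0
    have h1 : ‖toCLM K (e k)‖ = 1 := by
      refine le_antisymm (hK1 k) (le_of_mul_le_mul_right ?_ hpos)
      rw [one_mul]
      exact hk.symm.trans_le (real_inner_le_norm _ _)
    refine ⟨?_, Or.inr h1⟩
    have h2 := inner_eq_norm_mul_iff_real.1 (hk.trans (by rw [h1, one_mul]))
    rw [h1, one_smul] at h2
    exact h2.symm

/-- If `‖W‖ < 1`, this shows that `u ⊗ v + W` is a contraction, and that it preserves the norm of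
no vector off the line spanned by `u`. -/
theorem norm_sq_certificate_le {u : H₁} {v : H₂} (hu : ‖u‖ = 1) (hv : ‖v‖ = 1)
    {W : HilbertSchmidt H₁ H₂} (hWu : toCLM W u = 0)
    (hWv : ContinuousLinearMap.adjoint (toCLM W) v = 0) (x : H₁) :
    ‖toCLM (tensor u v + W) x‖ ^ 2 + (1 - ‖toCLM W‖ ^ 2) * ‖x - ⟪u, x⟫_ℝ • u‖ ^ 2 ≤ ‖x‖ ^ 2 := by
  have horth : ⟪⟪u, x⟫_ℝ • v, toCLM W x⟫_ℝ = 0 := by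
    rw [real_inner_smul_left, ← ContinuousLinearMap.adjoint_inner_left, hWv, inner_zero_left,
      mul_zero]
  have h1 : ‖toCLM (tensor u v + W) x‖ ^ 2 = ⟪u, x⟫_ℝ ^ 2 + ‖toCLM W x‖ ^ 2 := by
    rw [map_add, add_apply, toCLM_tensor_apply, norm_add_sq_real, horth, norm_smul, hv,
      Real.norm_eq_abs, mul_one, sq_abs]
    ring
  have h2 : ‖x - ⟪u, x⟫_ℝ • u‖ ^ 2 = ‖x‖ ^ 2 - ⟪u, x⟫_ℝ ^ 2 := by
    rw [norm_sub_sq_real, real_inner_smul_right, norm_smul, hu, Real.norm_eq_abs, mul_one, sq_abs,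
      real_inner_comm x u]
    ring
  have h3 : ‖toCLM W x‖ ^ 2 ≤ ‖toCLM W‖ ^ 2 * ‖x - ⟪u, x⟫_ℝ • u‖ ^ 2 := by
    have h := (toCLM W).le_opNorm (x - ⟪u, x⟫_ℝ • u)
    rw [map_sub, map_smul, hWu, smul_zero, sub_zero] at h
    rw [← mul_pow]
    exact pow_le_pow_left₀ (norm_nonneg _) h 2
  linarith

/-- The duality bound against the certificate `u ⊗ v + W`, and its rigidity: equality forces `G` to
lie on the ray spanned by `u ⊗ v`. -/
theorem inner_certificate_le {u : H₁} {v : H₂} (hu : ‖u‖ = 1) (hv : ‖v‖ = 1)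
    {W : HilbertSchmidt H₁ H₂} (hWu : toCLM W u = 0)
    (hWv : ContinuousLinearMap.adjoint (toCLM W) v = 0) (hW : ‖toCLM W‖ < 1)
    {G : HilbertSchmidt H₁ H₂} (hG : nuclearNorm G ≠ ∞) :
    ⟪tensor u v + W, G⟫_ℝ ≤ (nuclearNorm G).toReal ∧
      (⟪tensor u v + W, G⟫_ℝ = (nuclearNorm G).toReal → ∃ α : ℝ, 0 ≤ α ∧ G = α • tensor u v) := by
  have hW2 : 0 < 1 - ‖toCLM W‖ ^ 2 := by
    have := pow_lt_one₀ (norm_nonneg (toCLM W)) hW two_ne_zero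
    linarith
  have hcert := norm_sq_certificate_le hu hv hWu hWv
  obtain ⟨hle, heq⟩ := exists_basis_of_norm_le_one hG (K := tensor u v + W) fun x => by
    refine le_of_sq_le_sq ?_ (norm_nonneg x)
    have := hcert x
    have : 0 ≤ (1 - ‖toCLM W‖ ^ 2) * ‖x - ⟪u, x⟫_ℝ • u‖ ^ 2 := by positivity
    linarith
  refine ⟨hle, fun h => ?_⟩
  obtain ⟨ι, e, he⟩ := heq h
  by_cases hzero : ∀ k, toCLM G (e k) = 0
  · refine ⟨0, le_rfl, ?_⟩
    rw [zero_smul]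
    exact toCLM_injective (ext_basis e fun k => by rw [hzero k, map_zero, zero_apply])
  push Not at hzero
  obtain ⟨l, hl⟩ := hzero
  -- A basis vector not annihilated by `G` lies on the line of `u`; it is then `u` or `-u`, and by
  -- orthogonality there is only one such vector.
  have hline : ∀ k, toCLM G (e k) ≠ 0 → e k = ⟪u, e k⟫_ℝ • u := by
    intro k hk
    have h1 := (he k).2.resolve_left hk
    have h2 := hcert (e k)
    rw [h1, e.orthonormal.1 k] at h2
    have h3 : ‖e k - ⟪u, e k⟫_ℝ • u‖ ^ 2 ≤ 0 := nonpos_of_mul_nonpos_right (by linarith) hW2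
    have h4 : ‖e k - ⟪u, e k⟫_ℝ • u‖ = 0 :=
      (pow_eq_zero_iff two_ne_zero).1 (le_antisymm h3 (sq_nonneg _))
    exact sub_eq_zero.1 (norm_eq_zero.1 h4)
  have hul : ⟪u, e l⟫_ℝ ≠ 0 := fun h0 => hl (by rw [hline l hl, h0, zero_smul, map_zero])
  refine ⟨‖toCLM G (e l)‖, norm_nonneg _, toCLM_injective (ext_basis e fun k => ?_)⟩
  rw [map_smul, smul_apply, toCLM_tensor_apply]
  by_cases hkl : k = l
  · subst hkl
    have hK : toCLM (tensor u v + W) (e k) = ⟪u, e k⟫_ℝ • v := by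
      rw [map_add, add_apply, toCLM_tensor_apply, hline k hl, map_smul, hWu, smul_zero, add_zero,
        ← hline k hl]
    rw [← hK]
    exact (he k).1
  · have horth : ⟪u, e k⟫_ℝ = 0 := by
      have h0 : ⟪e l, e k⟫_ℝ = 0 := e.orthonormal.2 (Ne.symm hkl)
      rw [hline l hl, real_inner_smul_left] at h0
      exact (mul_eq_zero.1 h0).resolve_left hul
    rw [horth, zero_smul, smul_zero]
    by_contra hk
    exact hk (by rw [hline k hk, horth, zero_smul, map_zero])

end HilbertSchmidt

end RankOne

end NuclearRecovery

/-! ### Exact recovery -/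

theorem mainTheorem2
    {H₁ H₂ H : Type*}
    [NormedAddCommGroup H₁] [InnerProductSpace ℝ H₁] [CompleteSpace H₁]
    [TopologicalSpace.SeparableSpace H₁]
    [NormedAddCommGroup H₂] [InnerProductSpace ℝ H₂] [CompleteSpace H₂]
    [TopologicalSpace.SeparableSpace H₂]
    [NormedAddCommGroup H] [InnerProductSpace ℝ H] [CompleteSpace H]
    [TopologicalSpace.SeparableSpace H]
    (N : ℕ)
    (u : Fin N → H₁) (hu : ∀ i, ‖u i‖ = 1)
    (v : Fin N → H₂) (hv : ∀ i, ‖v i‖ = 1)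
    (σ : Fin N → ℝ) (hσ : ∀ i, 0 < σ i)
    (Φ : NuclearRecovery.HSTuple N H₁ H₂ →L[ℝ] H)
    (Fdag : NuclearRecovery.HSTuple N H₁ H₂)
    (hFdag : ∀ i, Fdag i = σ i • NuclearRecovery.HilbertSchmidt.tensor (u i) (v i))
    (z : H) (hz : z = Φ Fdag)
    (hsource : NuclearRecovery.NonDegenerateSourceCondition Φ u v)
    (hinj : Set.InjOn Φ (NuclearRecovery.modelCone u v)) :
    ∀ F : NuclearRecovery.HSTuple N H₁ H₂,
      NuclearRecovery.IsSolution Φ z F ↔ F = Fdag := by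
  classical
  open NuclearRecovery HilbertSchmidt in
  obtain ⟨_, ⟨y, rfl⟩, hcert⟩ := hsource
  set K := ContinuousLinearMap.adjoint Φ y with hKdef
  choose W hK hWu hWv hW using hcert
  -- `K` lies in the range of `Φ*`, so pairing with it is constant on the feasible set.
  have hfeas : ∀ G, Φ G = z → ∑ i, ⟪K i, G i⟫_ℝ = ∑ i, ⟪K i, Fdag i⟫_ℝ := by
    intro G hG
    rw [← PiLp.inner_apply, ← PiLp.inner_apply, hKdef, ContinuousLinearMap.adjoint_inner_left,
      ContinuousLinearMap.adjoint_inner_left, hG, hz]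
  have hdag : ∀ i, ⟪K i, Fdag i⟫_ℝ = σ i := by
    intro i
    rw [hK i, hFdag i, real_inner_smul_right, inner_add_left, inner_tensor_left,
      toCLM_tensor_apply, real_inner_smul_right, real_inner_comm (tensor (u i) (v i)),
      inner_tensor_left, hWu i]
    simp [hu i, hv i]
  have hcost : ∀ i, nuclearNorm (Fdag i) ≤ ENNReal.ofReal (σ i) := fun i => by
    rw [hFdag i]
    exact nuclearNorm_smul_tensor_le (hu i) (hv i) (hσ i)
  have hcost_sum : ∑ i, nuclearNorm (Fdag i) ≤ ENNReal.ofReal (∑ i, σ i) := by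
    rw [ENNReal.ofReal_sum_of_nonneg fun i _ => (hσ i).le]
    exact Finset.sum_le_sum fun i _ => hcost i
  have hdual : ∀ G : HSTuple N H₁ H₂, (∀ i, nuclearNorm (G i) ≠ ∞) → ∀ i,
      ⟪K i, G i⟫_ℝ ≤ (nuclearNorm (G i)).toReal ∧
        (⟪K i, G i⟫_ℝ = (nuclearNorm (G i)).toReal →
          ∃ α : ℝ, 0 ≤ α ∧ G i = α • tensor (u i) (v i)) := by
    intro G hG i
    rw [hK i]
    exact inner_certificate_le (hu i) (hv i) (hWu i) (hWv i) (hW i) (hG i)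
  have hsum : ∀ G, Φ G = z → ∑ i, ⟪K i, G i⟫_ℝ = ∑ i, σ i := fun G hG =>
    (hfeas G hG).trans (Finset.sum_congr rfl fun i _ => hdag i)
  have hopt : IsSolution Φ z Fdag := by
    refine ⟨hz.symm, fun G hG => ?_⟩
    by_cases hfin : ∀ i, nuclearNorm (G i) ≠ ∞
    · refine hcost_sum.trans ?_
      rw [← hsum G hG]
      refine ENNReal.ofReal_le_of_le_toReal ?_
      rw [ENNReal.toReal_sum fun i _ => hfin i]
      exact Finset.sum_le_sum fun i _ => (hdual G hfin i).1
    · push Not at hfin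
      obtain ⟨i, hi⟩ := hfin
      have htop : ∑ i, nuclearNorm (G i) = ∞ := ENNReal.sum_eq_top.2 ⟨i, Finset.mem_univ i, hi⟩
      exact le_top.trans_eq htop.symm
  intro F
  refine ⟨fun hF => ?_, fun hF => hF ▸ hopt⟩
  have hle : ∑ i, nuclearNorm (F i) ≤ ENNReal.ofReal (∑ i, σ i) :=
    (hF.2 Fdag hz.symm).trans hcost_sum
  have hfin : ∀ i, nuclearNorm (F i) ≠ ∞ := fun i =>
    ENNReal.sum_ne_top.1 (ne_top_of_le_ne_top ENNReal.ofReal_ne_top hle) i (Finset.mem_univ i)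
  have hle' : ∑ i, (nuclearNorm (F i)).toReal ≤ ∑ i, ⟪K i, F i⟫_ℝ := by
    rw [← ENNReal.toReal_sum fun i _ => hfin i, hsum F hF.1]
    exact ENNReal.toReal_le_of_le_ofReal (Finset.sum_nonneg fun i _ => (hσ i).le) hle
  have hterm : ∀ i ∈ Finset.univ, ⟪K i, F i⟫_ℝ ≤ (nuclearNorm (F i)).toReal :=
    fun i _ => (hdual F hfin i).1
  have heq := (Finset.sum_eq_sum_iff_of_le hterm).1
    (le_antisymm (Finset.sum_le_sum hterm) hle')
  refine hinj (fun i => (hdual F hfin i).2 (heq i (Finset.mem_univ i))) (fun i => ?_)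
    (hF.1.trans hz)
  exact ⟨σ i, (hσ i).le, hFdag i⟩
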